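/- Let $k$ be a field of characteristic $0$. Linear algebras over $k$ are vector spaces with a bilinear multiplication, not necessarily associative and without unit; homomorphisms are $k$-linear multiplicative maps. Let $E$ be an arbitrary set of identities with integer coefficients, that is, of non-associative polynomials without constant term over $\mathbb{Z}$ in countably many variables, and let $\Theta$ be the variety of all anticommutative algebras over $k$ (those with $xy=-yx$) in which $e=0$ holds identically for every $e\in E$. Assume that $\Theta$ contains a nonzero algebra. (For example, $\Theta$ may be the variety of all Lie algebras, with $E$ consisting of the Jacobi identity.) Let $\Theta^{0}$ be the category whose objects are the free algebras $F(X)$ of $\Theta$ generated by the finite subsets $X$ of a fixed countably infinite set of symbols, and whose morphisms are all homomorphisms between them. Let $\mathfrak{A}$ be the group of all automorphisms of the category $\Theta^{0}$ (functors $\Theta^0\to\Theta^0$ with a strict two-sided inverse), and let $\mathfrak{Y}$ be the normal subgroup of inner automorphisms, that is, of those that are isomorphic, as functors, to the identity functor. Then $$\mathfrak{A}/\mathfrak{Y}\cong \mathrm{Aut}\,k,$$ where $\mathrm{Aut}\,k$ is the group of all automorphisms of the field $k$. -/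

import Mathlib

open CategoryTheory

universe u

noncomputable section

namespace AnticommVariety

universe v w

/-- The linear algebra `A` over `k` (not necessarily associative, without unit) belongs to the
variety `Θ` defined, inside the variety of all anticommutative algebras, by the set `E` of
identities with integer coefficients.  An identity is a non-associative polynomial
`e = e(x₀, x₁, …)` over `ℤ`; it holds in `A` if `e(h₀, h₁, …) = 0` for all `h₀, h₁, … ∈ A`. -/
def InVariety (E : Set (FreeNonUnitalNonAssocAlgebra ℤ ℕ)) (A : Type v)
    [NonUnitalNonAssocRing A] : Prop :=
  (∀ a b : A, a * b = -(b * a)) ∧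
    ∀ e ∈ E, ∀ h : ℕ → A, FreeNonUnitalNonAssocAlgebra.lift ℤ h e = 0

section FreeAlgebra

variable (k : Type u) [Field k] (E : Set (FreeNonUnitalNonAssocAlgebra ℤ ℕ)) (X : Type v)

/-- The two-sided ideals `I` of the absolutely free algebra on `X` such that the quotient by `I`
satisfies anticommutativity and the identities in `E`. -/
structure IsVarietyIdeal (I : Submodule k (FreeNonUnitalNonAssocAlgebra k X)) : Prop where
  mul_left : ∀ a b, b ∈ I → a * b ∈ I
  mul_right : ∀ a b, a ∈ I → a * b ∈ I
  anticomm : ∀ a b, a * b + b * a ∈ I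
  identity : ∀ e ∈ E, ∀ h : ℕ → FreeNonUnitalNonAssocAlgebra k X,
    FreeNonUnitalNonAssocAlgebra.lift ℤ h e ∈ I

/-- The ideal of the absolutely free algebra on `X` generated by all the values of the defining
identities of the variety. -/
def verbalIdeal : Submodule k (FreeNonUnitalNonAssocAlgebra k X) :=
  sInf {I | IsVarietyIdeal k E X I}

theorem isVarietyIdeal_verbalIdeal : IsVarietyIdeal k E X (verbalIdeal k E X) where
  mul_left a b hb := by
    simp only [verbalIdeal, Submodule.mem_sInf, Set.mem_ofPred_eq] at hb ⊢
    exact fun I hI => hI.mul_left a b (hb I hI)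
  mul_right a b ha := by
    simp only [verbalIdeal, Submodule.mem_sInf, Set.mem_ofPred_eq] at ha ⊢
    exact fun I hI => hI.mul_right a b (ha I hI)
  anticomm a b := by
    simp only [verbalIdeal, Submodule.mem_sInf, Set.mem_ofPred_eq]
    exact fun I hI => hI.anticomm a b
  identity e he h := by
    simp only [verbalIdeal, Submodule.mem_sInf, Set.mem_ofPred_eq]
    exact fun I hI => hI.identity e he h

/-- The free algebra `F(X)` of the variety. -/
def FreeAlg : Type (max u v) :=
  FreeNonUnitalNonAssocAlgebra k X ⧸ verbalIdeal k E X

instance : AddCommGroup (FreeAlg k E X) :=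
  inferInstanceAs (AddCommGroup (FreeNonUnitalNonAssocAlgebra k X ⧸ verbalIdeal k E X))

instance : Module k (FreeAlg k E X) :=
  inferInstanceAs (Module k (FreeNonUnitalNonAssocAlgebra k X ⧸ verbalIdeal k E X))

/-- The quotient map from the absolutely free algebra, as a linear map. -/
def mk : FreeNonUnitalNonAssocAlgebra k X →ₗ[k] FreeAlg k E X :=
  (verbalIdeal k E X).mkQ

theorem mk_surjective : Function.Surjective (mk k E X) :=
  Submodule.mkQ_surjective _

theorem mk_eq_mk {a b : FreeNonUnitalNonAssocAlgebra k X} :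
    mk k E X a = mk k E X b ↔ a - b ∈ verbalIdeal k E X :=
  Submodule.Quotient.eq _

instance : Mul (FreeAlg k E X) where
  mul := Quotient.map₂ (· * ·) (by
    intro a a' ha b b' hb
    have ha' := (Submodule.quotientRel_def _).1 ha
    have hb' := (Submodule.quotientRel_def _).1 hb
    refine (Submodule.quotientRel_def _).2 ?_
    have hI := isVarietyIdeal_verbalIdeal k E X
    have := Submodule.add_mem _ (hI.mul_right _ b ha') (hI.mul_left a' _ hb')
    rwa [sub_mul, mul_sub, sub_add_sub_cancel] at this)

theorem mk_mul (a b : FreeNonUnitalNonAssocAlgebra k X) :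
    mk k E X (a * b) = mk k E X a * mk k E X b := rfl

instance : NonUnitalNonAssocRing (FreeAlg k E X) where
  left_distrib a b c := by
    obtain ⟨a, rfl⟩ := mk_surjective k E X a
    obtain ⟨b, rfl⟩ := mk_surjective k E X b
    obtain ⟨c, rfl⟩ := mk_surjective k E X c
    simp only [← map_add, ← mk_mul, mul_add]
  right_distrib a b c := by
    obtain ⟨a, rfl⟩ := mk_surjective k E X a
    obtain ⟨b, rfl⟩ := mk_surjective k E X b
    obtain ⟨c, rfl⟩ := mk_surjective k E X c
    simp only [← map_add, ← mk_mul, add_mul]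
  zero_mul a := by
    obtain ⟨a, rfl⟩ := mk_surjective k E X a
    rw [← map_zero (mk k E X), ← mk_mul, zero_mul]
  mul_zero a := by
    obtain ⟨a, rfl⟩ := mk_surjective k E X a
    rw [← map_zero (mk k E X), ← mk_mul, mul_zero]

instance : IsScalarTower k (FreeAlg k E X) (FreeAlg k E X) where
  smul_assoc r a b := by
    obtain ⟨a, rfl⟩ := mk_surjective k E X a
    obtain ⟨b, rfl⟩ := mk_surjective k E X b
    simp only [smul_eq_mul, ← map_smul, ← mk_mul, smul_mul_assoc]

instance : SMulCommClass k (FreeAlg k E X) (FreeAlg k E X) where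
  smul_comm r a b := by
    obtain ⟨a, rfl⟩ := mk_surjective k E X a
    obtain ⟨b, rfl⟩ := mk_surjective k E X b
    simp only [smul_eq_mul, ← map_smul, ← mk_mul, mul_smul_comm]

/-- `F(X)` belongs to the variety. -/
theorem inVariety_freeAlg : InVariety E (FreeAlg k E X) := by
  have hI := isVarietyIdeal_verbalIdeal k E X
  refine ⟨fun a b => ?_, fun e he h => ?_⟩
  · obtain ⟨a, rfl⟩ := mk_surjective k E X a
    obtain ⟨b, rfl⟩ := mk_surjective k E X b
    rw [← mk_mul, ← mk_mul, ← map_neg, mk_eq_mk, sub_neg_eq_add]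
    exact hI.anticomm a b
  · choose g hg using fun n => mk_surjective k E X (h n)
    let q : FreeNonUnitalNonAssocAlgebra k X →ₙₐ[ℤ] FreeAlg k E X :=
      { toFun := mk k E X
        map_smul' := fun n a => map_zsmul (mk k E X) n a
        map_zero' := map_zero _
        map_add' := map_add _
        map_mul' := mk_mul k E X }
    have hq : q.comp (FreeNonUnitalNonAssocAlgebra.lift ℤ g) =
        FreeNonUnitalNonAssocAlgebra.lift ℤ h := by
      apply FreeNonUnitalNonAssocAlgebra.hom_ext
      intro n
      simpa [q] using hg n
    rw [← hq]
    have := (mk_eq_mk k E X (a := FreeNonUnitalNonAssocAlgebra.lift ℤ g e) (b := 0)).2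
      (by simpa using hI.identity e he g)
    simpa [q] using this

/-- The free generators of `F(X)`. -/
def of (x : X) : FreeAlg k E X := mk k E X (FreeNonUnitalNonAssocAlgebra.of k x)

/-- `F(X)` is free on `X` in the variety: maps from `X` to an algebra of the variety extend
uniquely to homomorphisms. -/
theorem existsUnique_hom (A : Type w) [NonUnitalNonAssocRing A] [Module k A]
    [IsScalarTower k A A] [SMulCommClass k A A] (hA : InVariety E A) (f : X → A) :
    ∃! φ : FreeAlg k E X →ₙₐ[k] A, ∀ x, φ (of k E X x) = f x := by
  let L := FreeNonUnitalNonAssocAlgebra.lift k f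
  let l : FreeNonUnitalNonAssocAlgebra k X →ₗ[k] A :=
    { toFun := L, map_add' := map_add L, map_smul' := map_smul L }
  have hl : IsVarietyIdeal k E X (LinearMap.ker l) :=
    { mul_left := fun a b hb => by
        have hb : L b = 0 := hb
        change L (a * b) = 0
        rw [map_mul, hb, mul_zero]
      mul_right := fun a b ha => by
        have ha : L a = 0 := ha
        change L (a * b) = 0
        rw [map_mul, ha, zero_mul]
      anticomm := fun a b => by
        change L (a * b + b * a) = 0
        rw [map_add, map_mul, map_mul, hA.1 (L a) (L b), neg_add_cancel]
      identity := fun e he h => by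
        let q : FreeNonUnitalNonAssocAlgebra k X →ₙₐ[ℤ] A :=
          { toFun := L
            map_smul' := fun n a => map_zsmul L n a
            map_zero' := map_zero _
            map_add' := map_add _
            map_mul' := map_mul _ }
        have hq : q.comp (FreeNonUnitalNonAssocAlgebra.lift ℤ h) =
            FreeNonUnitalNonAssocAlgebra.lift ℤ (L ∘ h) := by
          apply FreeNonUnitalNonAssocAlgebra.hom_ext
          intro n
          simp [q]
        have := hA.2 e he (L ∘ h)
        rw [← hq] at this
        exact this }
  have hle : verbalIdeal k E X ≤ LinearMap.ker l := sInf_le hl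
  let ψ : FreeAlg k E X →ₗ[k] A := (verbalIdeal k E X).liftQ l hle
  have hψ : ∀ a, ψ (mk k E X a) = L a := fun a => rfl
  refine ⟨{ toFun := ψ
            map_smul' := map_smul ψ
            map_zero' := map_zero ψ
            map_add' := map_add ψ
            map_mul' := fun a b => ?_ }, fun x => ?_, fun φ hφ => ?_⟩
  · obtain ⟨a, rfl⟩ := mk_surjective k E X a
    obtain ⟨b, rfl⟩ := mk_surjective k E X b
    rw [← mk_mul, hψ, hψ, hψ, map_mul]
  · exact (hψ _).trans (FreeNonUnitalNonAssocAlgebra.lift_of_apply k f x)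
  · let p : FreeNonUnitalNonAssocAlgebra k X →ₙₐ[k] FreeAlg k E X :=
      { toFun := mk k E X
        map_smul' := map_smul (mk k E X)
        map_zero' := map_zero _
        map_add' := map_add _
        map_mul' := mk_mul k E X }
    have hp : φ.comp p = L := by
      apply FreeNonUnitalNonAssocAlgebra.hom_ext
      intro x
      exact (hφ x).trans (FreeNonUnitalNonAssocAlgebra.lift_of_apply k f x).symm
    ext a
    obtain ⟨a, rfl⟩ := mk_surjective k E X a
    exact (congrArg (fun g => g a) hp).trans (hψ a).symm

end FreeAlgebra

/-- The category `Θ⁰` of the free algebras of the variety `Θ` generated by the finite subsets of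
a fixed countable set of symbols, here `ℕ`.  The object with `gens = X` is `F(X)`. -/
structure FreeCat (k : Type u) [Field k] (E : Set (FreeNonUnitalNonAssocAlgebra ℤ ℕ)) where
  gens : Finset ℕ

/-- Morphisms of `Θ⁰` are all homomorphisms of algebras over `k`. -/
instance (k : Type u) [Field k] (E : Set (FreeNonUnitalNonAssocAlgebra ℤ ℕ)) :
    Category.{u} (FreeCat k E) where
  Hom A B := FreeAlg k E A.gens →ₙₐ[k] FreeAlg k E B.gens
  id A := NonUnitalAlgHom.id k (FreeAlg k E A.gens)
  comp f g := g.comp f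

end AnticommVariety

/-- The group of all automorphisms of a category `C`: functors `C ⥤ C` which have a strict
two-sided inverse functor, with composition `(Φ * Ψ)(A) = Φ(Ψ(A))`. -/
abbrev CategoryAut (C : Type*) [Category C] : Type _ := Aut (Cat.of C)

/-- The normal subgroup of inner automorphisms of a category: those which are isomorphic, as
functors, to the identity functor. -/
def innerAut (C : Type*) [Category C] : Subgroup (CategoryAut C) where
  carrier := {Φ | Nonempty (𝟭 C ≅ Φ.hom.toFunctor)}
  one_mem' := ⟨Iso.refl _⟩
  mul_mem' := by
    rintro Φ Ψ ⟨i⟩ ⟨j⟩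
    exact ⟨j ≪≫ (Functor.rightUnitor _).symm ≪≫ Functor.isoWhiskerLeft Ψ.hom.toFunctor i⟩
  inv_mem' := by
    rintro Φ ⟨i⟩
    have h : Φ.hom.toFunctor ⋙ Φ.inv.toFunctor = 𝟭 C :=
      congrArg Cat.Hom.toFunctor Φ.hom_inv_id
    exact ⟨(eqToIso h).symm ≪≫ (Functor.isoWhiskerRight i Φ.inv.toFunctor).symm ≪≫
      Functor.leftUnitor _⟩

instance innerAut_normal (C : Type*) [Category C] : (innerAut C).Normal where
  conj_mem := by
    rintro Φ ⟨i⟩ Ψ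
    have h : Ψ.inv.toFunctor ⋙ Ψ.hom.toFunctor = 𝟭 C :=
      congrArg Cat.Hom.toFunctor Ψ.inv_hom_id
    exact ⟨(eqToIso h).symm ≪≫ Functor.isoWhiskerLeft Ψ.inv.toFunctor
      ((Functor.leftUnitor _).symm ≪≫ Functor.isoWhiskerRight i Ψ.hom.toFunctor)⟩

end

/-! An equivalence `G` of the category with itself determines a unique field automorphism `σ` such
that `G` comes, up to natural σ-semilinear ring isomorphisms, from `σ` (`exists_isSemilinear`,
`IsSemilinear.unique`). The map `Φ ↦ σ` is a homomorphism; its kernel is the inner automorphisms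
(`isSemilinear_refl_iff`), and conjugation by semilinear maps fixing the generators makes it
surjective.

Existence of `σ`: anticommutativity in characteristic 0 gives `x * x = 0`, so `F(x) = kx`, and `G`
sends `F(x)` to a free algebra on one generator. Elements of `F(Y)` are morphisms `F(x) ⟶ F(Y)`, so
`G` induces natural bijections `s` (`transport`) from `F(Y)` to `G(F(Y))`. Scalars are the
endomorphisms of `F(x)`, whence `s (c • a) = φ c • s a`. Since `G` preserves freeness on two
generators, `s (a + b)` and `s (a * b)` are values at `s a`, `s b` of elements `q` of the free
algebra on two generators. Scaling by 2 makes `q` homogeneous of degree 1, resp. 2: addition is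
preserved, and `s (a * b) = r • (s a * s b)`. Then `r • s` is a ring isomorphism; if `r = 0`, all
products vanish and `s` itself works. -/

noncomputable section

namespace AnticommVariety

universe v w

/-! ### Free algebras and their monomials -/

section FreeAlgebra

variable {k : Type u} [Field k] {E : Set (FreeNonUnitalNonAssocAlgebra ℤ ℕ)}

section Basic

variable {X : Type v}

/-- The homomorphism from a free algebra determined by the images of the generators. -/
def freeLift {A : Type w} [NonUnitalNonAssocRing A] [Module k A] [IsScalarTower k A A]
    [SMulCommClass k A A] (hA : InVariety E A) (f : X → A) : FreeAlg k E X →ₙₐ[k] A :=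
  (existsUnique_hom k E X A hA f).choose

@[simp]
theorem freeLift_of {A : Type w} [NonUnitalNonAssocRing A] [Module k A] [IsScalarTower k A A]
    [SMulCommClass k A A] (hA : InVariety E A) (f : X → A) (x : X) :
    freeLift hA f (of k E X x) = f x :=
  (existsUnique_hom k E X A hA f).choose_spec.1 x

theorem freeAlg_hom_ext {A : Type w} [NonUnitalNonAssocRing A] [Module k A]
    [IsScalarTower k A A] [SMulCommClass k A A] (hA : InVariety E A)
    {f g : FreeAlg k E X →ₙₐ[k] A} (h : ∀ x, f (of k E X x) = g (of k E X x)) : f = g :=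
  (existsUnique_hom k E X A hA fun x => g (of k E X x)).unique h fun _ => rfl

/-- The value in a free algebra of a non-associative word in the generators. -/
def monomial (k : Type u) [Field k] (E : Set (FreeNonUnitalNonAssocAlgebra ℤ ℕ))
    (m : FreeMagma X) : FreeAlg k E X :=
  mk k E X (MonoidAlgebra.single m 1)

theorem monomial_of (x : X) : monomial k E (FreeMagma.of x) = of k E X x := rfl

theorem monomial_mul (m n : FreeMagma X) :
    monomial k E (m * n) = monomial k E m * monomial k E n := by
  rw [monomial, monomial, monomial, ← mk_mul, MonoidAlgebra.single_mul_single, one_mul]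

theorem exists_eq_sum_monomial (a : FreeAlg k E X) :
    ∃ (s : Finset (FreeMagma X)) (c : FreeMagma X → k),
      a = ∑ m ∈ s, c m • monomial k E m := by
  obtain ⟨p, rfl⟩ := mk_surjective k E X a
  have hp : p ∈ Submodule.span k (Set.range fun m : FreeMagma X =>
      (MonoidAlgebra.single m 1 : MonoidAlgebra k (FreeMagma X))) := by
    induction p using MonoidAlgebra.induction_linear with
    | zero => exact zero_mem _
    | add f g hf hg => exact add_mem hf hg
    | single m r =>
      have : (MonoidAlgebra.single m r : MonoidAlgebra k (FreeMagma X)) =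
          r • MonoidAlgebra.single m 1 := by simp
      rw [this]
      exact Submodule.smul_mem _ _ (Submodule.subset_span ⟨m, rfl⟩)
  obtain ⟨c, rfl⟩ := (Finsupp.mem_span_range_iff_exists_finsupp).1 hp
  refine ⟨c.support, c, ?_⟩
  rw [Finsupp.sum]
  refine (map_sum (mk k E X) _ _).trans ?_
  exact Finset.sum_congr rfl fun m _ => map_smul (mk k E X) _ _

theorem map_monomial_of_smul {r : k} (f : FreeAlg k E X →ₙₐ[k] FreeAlg k E X)
    (hf : ∀ x, f (of k E X x) = r • of k E X x) (m : FreeMagma X) :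
    f (monomial k E m) = r ^ m.length • monomial k E m := by
  induction m with
  | ih1 x =>
    have : (FreeMagma.of x).length = 1 := rfl
    rw [monomial_of, hf, this, pow_one]
  | ih2 a b ha hb =>
    have : (a * b).length = a.length + b.length := rfl
    rw [monomial_mul, map_mul, ha, hb, this, pow_add, smul_mul_smul_comm]

end Basic

/-! ### Homogeneous components -/

/-- The product of `X - c` over the eigenvalues `c ≠ r`, evaluated at `T`, kills the other terms and
multiplies both sides by the same nonzero scalar. The `v i` may be linearly dependent, as monomials
in a free algebra of the variety are. -/
theorem eq_sum_filter_of_eigenvectors {V ι : Type*} [AddCommGroup V] [Module k V]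
    (T : V →ₗ[k] V) (s : Finset ι) (v : ι → V) (μ : ι → k) (r : k)
    (hv : ∀ i ∈ s, T (v i) = μ i • v i) (hr : T (∑ i ∈ s, v i) = r • ∑ i ∈ s, v i) :
    open scoped Classical in ∑ i ∈ s, v i = ∑ i ∈ s with μ i = r, v i := by
  classical
  have key : ∀ (p : Polynomial k) (x : V) (c : k), T x = c • x →
      Polynomial.aeval T p x = p.eval c • x := by
    intro p x c h
    induction p using Polynomial.induction_on' with
    | add p q hp hq => simp [hp, hq, add_smul]
    | monomial n a =>
      have hn : ∀ n : ℕ, (T ^ n) x = c ^ n • x := by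
        intro n
        induction n with
        | zero => simp
        | succ n ih => rw [pow_succ', Module.End.mul_apply, ih, map_smul, h, smul_smul, pow_succ]
      simp [Polynomial.aeval_monomial, hn, smul_smul, Module.algebraMap_end_apply, mul_comm]
  let S : Finset k := (s.image μ).erase r
  let p : Polynomial k := ∏ c ∈ S, (Polynomial.X - Polynomial.C c)
  have hpr : p.eval r ≠ 0 := by
    simp only [p, Polynomial.eval_prod, Finset.prod_ne_zero_iff]
    intro c hc
    simpa [sub_eq_zero] using (Finset.ne_of_mem_erase hc).symm
  have hp0 : ∀ i ∈ s, μ i ≠ r → p.eval (μ i) = 0 := by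
    intro i hi h
    simp only [p, Polynomial.eval_prod]
    exact Finset.prod_eq_zero (Finset.mem_erase.2 ⟨h, Finset.mem_image_of_mem μ hi⟩) (by simp)
  have h1 := key p _ r hr
  rw [map_sum, Finset.sum_congr rfl fun i hi => key p (v i) (μ i) (hv i hi)] at h1
  have h2 : ∑ i ∈ s, p.eval (μ i) • v i = p.eval r • ∑ i ∈ s with μ i = r, v i := by
    rw [Finset.smul_sum, Finset.sum_filter]
    refine Finset.sum_congr rfl fun i hi => ?_
    split_ifs with h
    · rw [h]
    · rw [hp0 i hi h, zero_smul]
  exact smul_right_injective V hpr (h1.symm.trans h2)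

variable {X : Type v}

/-- Monomials of degree `d` are eigenvectors for `2 ^ d`, and these powers are distinct in
characteristic 0. Homogeneity of the defining identities is not needed. -/
theorem mem_span_monomial_of_smul [CharZero k] (f : FreeAlg k E X →ₙₐ[k] FreeAlg k E X)
    (hf : ∀ x, f (of k E X x) = (2 : k) • of k E X x) (n : ℕ) (a : FreeAlg k E X)
    (ha : f a = (2 ^ n : k) • a) :
    a ∈ Submodule.span k (monomial k E '' {m : FreeMagma X | m.length = n}) := by
  classical
  obtain ⟨s, c, rfl⟩ := exists_eq_sum_monomial a
  rw [eq_sum_filter_of_eigenvectors (f : FreeAlg k E X →ₗ[k] FreeAlg k E X) s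
    (fun m => c m • monomial k E m) (fun m => 2 ^ m.length) (2 ^ n) ?_ ha]
  · refine Submodule.sum_mem _ fun m hm => Submodule.smul_mem _ _ (Submodule.subset_span ?_)
    refine ⟨m, ?_, rfl⟩
    have h := (Finset.mem_filter.1 hm).2
    have h' : (2 : ℕ) ^ m.length = 2 ^ n := by exact_mod_cast h
    exact Nat.pow_right_injective le_rfl h'
  · intro m _
    change f (c m • monomial k E m) = _
    rw [map_smul, map_monomial_of_smul f hf, smul_comm]

theorem _root_.FreeMagma.exists_of_length_eq_one {m : FreeMagma X} (h : m.length = 1) :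
    ∃ x, m = FreeMagma.of x := by
  induction m with
  | ih1 x => exact ⟨x, rfl⟩
  | ih2 a b =>
    have := a.length_pos
    have := b.length_pos
    have : (a * b).length = a.length + b.length := rfl
    omega

theorem _root_.FreeMagma.exists_of_length_eq_two {m : FreeMagma X} (h : m.length = 2) :
    ∃ x y, m = FreeMagma.of x * FreeMagma.of y := by
  induction m with
  | ih1 x => exact absurd h (by decide : (1 : ℕ) ≠ 2)
  | ih2 a b =>
    have h1 := a.length_pos
    have h2 := b.length_pos
    have : (a * b).length = a.length + b.length := rfl
    obtain ⟨x, rfl⟩ := FreeMagma.exists_of_length_eq_one (m := a) (by omega)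
    obtain ⟨y, rfl⟩ := FreeMagma.exists_of_length_eq_one (m := b) (by omega)
    exact ⟨x, y, rfl⟩

theorem InVariety.mul_self [CharZero k] {A : Type w} [NonUnitalNonAssocRing A] [Module k A]
    (hA : InVariety E A) (a : A) : a * a = 0 := by
  have h := eq_neg_iff_add_eq_zero.1 (hA.1 a a)
  rw [← two_smul k] at h
  exact (smul_eq_zero.1 h).resolve_left two_ne_zero

/-- Any product of multiples of the generator `x` is a multiple of `x * x = 0`. -/
theorem freeAlg_eq_smul_of [CharZero k] [Unique X] (a : FreeAlg k E X) :
    ∃ c : k, a = c • of k E X default := by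
  have hm : ∀ m : FreeMagma X, ∃ c : k, monomial k E m = c • of k E X default := by
    intro m
    induction m with
    | ih1 x => exact ⟨1, by rw [monomial_of, one_smul, Unique.eq_default x]⟩
    | ih2 a b ha hb =>
      obtain ⟨c, hc⟩ := ha
      obtain ⟨d, hd⟩ := hb
      refine ⟨0, ?_⟩
      rw [monomial_mul, hc, hd, smul_mul_smul_comm,
        (inVariety_freeAlg k E X).mul_self (k := k), smul_zero, zero_smul]
  choose d hd using hm
  obtain ⟨s, c, rfl⟩ := exists_eq_sum_monomial a
  refine ⟨∑ m ∈ s, c m * d m, ?_⟩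
  rw [Finset.sum_smul]
  exact Finset.sum_congr rfl fun m _ => by rw [hd, smul_smul]

instance [IsEmpty X] : Subsingleton (FreeAlg k E X) := by
  refine subsingleton_of_forall_eq 0 fun a => ?_
  have h : NonUnitalAlgHom.id k (FreeAlg k E X) = 0 :=
    freeAlg_hom_ext (inVariety_freeAlg k E X) fun x => isEmptyElim x
  exact congrArg (fun f => f a) h

/-- Generators can be sent to a nonzero element of an algebra of the variety. Nontriviality of the
variety enters only here. -/
theorem of_ne_zero (hE : ∃ (A : Type u) (_ : NonUnitalNonAssocRing A) (_ : Module k A)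
      (_ : IsScalarTower k A A) (_ : SMulCommClass k A A), InVariety E A ∧ Nontrivial A) (x : X) :
    of k E X x ≠ 0 := by
  obtain ⟨A, _, _, _, _, hA, _⟩ := hE
  obtain ⟨a, ha⟩ := exists_ne (0 : A)
  intro h
  apply ha
  have := freeLift_of (k := k) hA (fun _ : X => a) x
  rw [h, map_zero] at this
  exact this.symm

/-! ### Semilinear automorphisms of free algebras -/

/-- The algebra `A` with scalars acting through the endomorphism `σ` of the ground field. -/
def Twist (_σ : k →+* k) (A : Type w) : Type w := A

instance (σ : k →+* k) (A : Type w) [h : NonUnitalNonAssocRing A] :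
    NonUnitalNonAssocRing (Twist σ A) := h

instance (σ : k →+* k) (A : Type w) [NonUnitalNonAssocRing A] [Module k A] :
    Module k (Twist σ A) := Module.compHom A σ

instance (σ : k →+* k) (A : Type w) [NonUnitalNonAssocRing A] [Module k A]
    [IsScalarTower k A A] : IsScalarTower k (Twist σ A) (Twist σ A) where
  smul_assoc c a b := smul_mul_assoc (σ c) (show A from a) (show A from b)

instance (σ : k →+* k) (A : Type w) [NonUnitalNonAssocRing A] [Module k A]
    [SMulCommClass k A A] : SMulCommClass k (Twist σ A) (Twist σ A) where
  smul_comm c a b := (mul_smul_comm (σ c) (show A from a) (show A from b)).symm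

/-- The semilinear ring endomorphism of a free algebra which fixes the generators. -/
def semiHom (E : Set (FreeNonUnitalNonAssocAlgebra ℤ ℕ)) (X : Type v) (σ : k →+* k) :
    FreeAlg k E X →ₙ+* FreeAlg k E X :=
  -- The identities have integer coefficients, so `InVariety` depends only on the ring structure and
  -- survives the twist.
  ((freeLift (A := Twist σ (FreeAlg k E X)) (inVariety_freeAlg k E X) (of k E X) :
    FreeAlg k E X →ₙₐ[k] Twist σ (FreeAlg k E X)) :
      FreeAlg k E X →ₙ+* Twist σ (FreeAlg k E X))

theorem semiHom_smul (σ : k →+* k) (c : k) (a : FreeAlg k E X) :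
    semiHom E X σ (c • a) = σ c • semiHom E X σ a :=
  map_smul (freeLift (A := Twist σ (FreeAlg k E X)) (inVariety_freeAlg k E X) (of k E X)) c a

theorem semiHom_of (σ : k →+* k) (x : X) : semiHom E X σ (of k E X x) = of k E X x :=
  freeLift_of (A := Twist σ (FreeAlg k E X)) (inVariety_freeAlg k E X) (of k E X) x

theorem semiHom_semiHom {σ τ : k →+* k} (h : σ.comp τ = RingHom.id k) (a : FreeAlg k E X) :
    semiHom E X σ (semiHom E X τ a) = a := by
  let f : FreeAlg k E X →ₙₐ[k] FreeAlg k E X :=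
    { (semiHom E X σ).comp (semiHom E X τ) with
      map_smul' := fun c a => by
        change semiHom E X σ (semiHom E X τ (c • a)) = c • semiHom E X σ (semiHom E X τ a)
        rw [semiHom_smul, semiHom_smul]
        exact congrArg (· • _) (congrArg (fun g => g c) h) }
  have hf : f = NonUnitalAlgHom.id k _ := by
    refine freeAlg_hom_ext (inVariety_freeAlg k E X) fun x => ?_
    change semiHom E X σ (semiHom E X τ _) = _
    rw [semiHom_of, semiHom_of]
    rfl
  exact congrArg (fun g => g a) hf

/-- The semilinear ring automorphism of a free algebra which fixes the generators. -/
def semiEquiv (E : Set (FreeNonUnitalNonAssocAlgebra ℤ ℕ)) (X : Type v) (σ : k ≃+* k) :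
    FreeAlg k E X ≃+* FreeAlg k E X :=
  { semiHom E X (σ : k →+* k) with
    invFun := semiHom E X (σ.symm : k →+* k)
    left_inv := fun a => semiHom_semiHom (by simp) a
    right_inv := fun a => semiHom_semiHom (by simp) a }

theorem semiEquiv_smul (σ : k ≃+* k) (c : k) (a : FreeAlg k E X) :
    semiEquiv E X σ (c • a) = σ c • semiEquiv E X σ a :=
  semiHom_smul _ c a

theorem semiEquiv_symm_smul (σ : k ≃+* k) (c : k) (a : FreeAlg k E X) :
    (semiEquiv E X σ).symm (c • a) = σ.symm c • (semiEquiv E X σ).symm a :=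
  semiHom_smul _ c a

end FreeAlgebra

/-! ### Semilinear functors -/

section Semilinear

variable {k : Type u} [Field k] {E : Set (FreeNonUnitalNonAssocAlgebra ℤ ℕ)}

/-- A morphism of `Θ⁰` as a homomorphism of algebras. -/
abbrev algHom {Y Z : FreeCat k E} (f : Y ⟶ Z) :
    FreeAlg k E Y.gens →ₙₐ[k] FreeAlg k E Z.gens := f

theorem algHom_comp {X Y Z : FreeCat k E} (f : X ⟶ Y) (g : Y ⟶ Z) (a : FreeAlg k E X.gens) :
    algHom (f ≫ g) a = algHom g (algHom f a) := rfl

theorem algHom_id (X : FreeCat k E) (a : FreeAlg k E X.gens) : algHom (𝟙 X) a = a := rfl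

/-- The morphism of `Θ⁰` determined by the images of the generators. -/
def homMk {Y Z : FreeCat k E} (f : Y.gens → FreeAlg k E Z.gens) : Y ⟶ Z :=
  freeLift (inVariety_freeAlg k E Z.gens) f

theorem homMk_of {Y Z : FreeCat k E} (f : Y.gens → FreeAlg k E Z.gens) (x : Y.gens) :
    algHom (homMk f) (of k E Y.gens x) = f x :=
  freeLift_of _ f x

theorem freeCat_hom_ext {Y Z : FreeCat k E} {f g : Y ⟶ Z}
    (h : ∀ x, algHom f (of k E Y.gens x) = algHom g (of k E Y.gens x)) : f = g :=
  freeAlg_hom_ext (inVariety_freeAlg k E Z.gens) h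

/-- The endofunctor `G` of `Θ⁰` is given, up to a natural family of ring isomorphisms
`F(Y) ≃ G(F(Y))`, by the automorphism `σ` of the ground field. -/
def IsSemilinear (G : FreeCat k E ⥤ FreeCat k E) (σ : k ≃+* k) : Prop :=
  ∃ t : ∀ Y : FreeCat k E, FreeAlg k E Y.gens ≃+* FreeAlg k E (G.obj Y).gens,
    (∀ Y (c : k) a, t Y (c • a) = σ c • t Y a) ∧
      ∀ {Y Z : FreeCat k E} (f : Y ⟶ Z) a, t Z (algHom f a) = algHom (G.map f) (t Y a)

theorem IsSemilinear.comp {G H : FreeCat k E ⥤ FreeCat k E} {σ τ : k ≃+* k}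
    (hG : IsSemilinear G σ) (hH : IsSemilinear H τ) : IsSemilinear (G ⋙ H) (σ.trans τ) := by
  obtain ⟨t, ht, ht'⟩ := hG
  obtain ⟨s, hs, hs'⟩ := hH
  refine ⟨fun Y => (t Y).trans (s (G.obj Y)), fun Y c a => ?_, fun {Y Z} f a => ?_⟩
  · simp only [RingEquiv.coe_trans, Function.comp_apply, ht, hs]
  · simp only [RingEquiv.coe_trans, Function.comp_apply, ht', hs', Functor.comp_map]

/-- The object of `Θ⁰` with a single generator. -/
def single (k : Type u) [Field k] (E : Set (FreeNonUnitalNonAssocAlgebra ℤ ℕ)) : FreeCat k E :=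
  ⟨{0}⟩

instance : Unique (single k E).gens := inferInstanceAs (Unique ({0} : Finset ℕ))

/-- The generator of the free algebra with a single generator. -/
def gen (k : Type u) [Field k] (E : Set (FreeNonUnitalNonAssocAlgebra ℤ ℕ)) :
    FreeAlg k E (single k E).gens :=
  of k E _ default

/-- An element of a free algebra as a morphism from the free algebra with a single generator. -/
def elem {Y : FreeCat k E} (a : FreeAlg k E Y.gens) : single k E ⟶ Y :=
  homMk fun _ => a

theorem elem_gen {Y : FreeCat k E} (a : FreeAlg k E Y.gens) : algHom (elem a) (gen k E) = a :=
  homMk_of _ _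

theorem single_hom_ext {Y : FreeCat k E} {f g : single k E ⟶ Y}
    (h : algHom f (gen k E) = algHom g (gen k E)) : f = g :=
  freeCat_hom_ext fun x => by rw [Unique.eq_default x]; exact h

/-- Multiplication by `c` is an endomorphism of `F(x)`. Its image under `G` multiplies `t x` by `σ
c`, and also by `τ c`, because `t x = s v` for a multiple `v` of `x`. -/
theorem IsSemilinear.unique
    (hE : ∃ (A : Type u) (_ : NonUnitalNonAssocRing A) (_ : Module k A)
      (_ : IsScalarTower k A A) (_ : SMulCommClass k A A), InVariety E A ∧ Nontrivial A)
    [CharZero k] {G : FreeCat k E ⥤ FreeCat k E} {σ τ : k ≃+* k}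
    (hσ : IsSemilinear G σ) (hτ : IsSemilinear G τ) : σ = τ := by
  obtain ⟨t, ht, ht'⟩ := hσ
  obtain ⟨s, hs, hs'⟩ := hτ
  ext c
  let v := (s (single k E)).symm (t _ (gen k E))
  have hv : v ≠ 0 :=
    (RingEquiv.map_ne_zero_iff _).2 ((RingEquiv.map_ne_zero_iff _).2 (of_ne_zero hE default))
  obtain ⟨d, hd⟩ := freeAlg_eq_smul_of v
  have h1 : algHom (elem (c • gen k E)) v = c • v := by
    rw [hd, map_smul]
    exact (congrArg (d • ·) (elem_gen _)).trans (smul_comm _ _ _)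
  have h2 := congrArg (s _) h1
  rw [hs', hs, RingEquiv.apply_symm_apply, ← ht', elem_gen, ht] at h2
  have : t _ (gen k E) ≠ 0 :=
    (RingEquiv.map_ne_zero_iff _).2 (of_ne_zero hE default)
  exact smul_left_injective k this h2

theorem isSemilinear_refl_iff (G : FreeCat k E ⥤ FreeCat k E) :
    IsSemilinear G (RingEquiv.refl k) ↔ Nonempty (𝟭 (FreeCat k E) ≅ G) := by
  constructor
  · rintro ⟨t, ht, ht'⟩
    refine ⟨NatIso.ofComponents (fun Y => ?_) fun {Y Z} f => ?_⟩
    · exact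
        { hom := ({ t Y with
                    map_smul' := ht Y
                    map_zero' := map_zero (t Y) } :
                  FreeAlg k E Y.gens →ₙₐ[k] FreeAlg k E (G.obj Y).gens)
          inv := ({ (t Y).symm with
                    map_smul' := fun c a => by
                      apply (t Y).injective
                      refine ((t Y).apply_symm_apply _).trans ?_
                      refine .trans ?_ (ht Y c _).symm
                      exact congrArg (c • ·) ((t Y).apply_symm_apply a).symm
                    map_zero' := map_zero (t Y).symm } :
                  FreeAlg k E (G.obj Y).gens →ₙₐ[k] FreeAlg k E Y.gens)
          hom_inv_id := NonUnitalAlgHom.ext fun a => (t Y).symm_apply_apply a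
          inv_hom_id := NonUnitalAlgHom.ext fun a => (t Y).apply_symm_apply a }
    · exact NonUnitalAlgHom.ext fun a => ht' f a
  · rintro ⟨i⟩
    refine ⟨fun Y =>
      { algHom (i.hom.app Y) with
        invFun := algHom (i.inv.app Y)
        left_inv := fun a => ?_
        right_inv := fun a => ?_
        map_mul' := map_mul (algHom (i.hom.app Y))
        map_add' := map_add (algHom (i.hom.app Y)) },
      fun Y c a => map_smul (algHom (i.hom.app Y)) c a, fun {Y Z} f a => ?_⟩
    · exact congrArg (fun g => algHom g a) (i.hom_inv_id_app Y)
    · exact congrArg (fun g => algHom g a) (i.inv_hom_id_app Y)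
    · exact congrArg (fun g => algHom g a) (i.hom.naturality f)

/-! ### Functors defined by field automorphisms -/

/-- The endofunctor of `Θ⁰` which conjugates the homomorphisms by the semilinear automorphisms
fixing the generators. -/
def twistFunctor (E : Set (FreeNonUnitalNonAssocAlgebra ℤ ℕ)) (σ : k ≃+* k) :
    FreeCat k E ⥤ FreeCat k E where
  obj Y := Y
  map {Y Z} f :=
    ({ ((semiEquiv E Z.gens σ : FreeAlg k E Z.gens →ₙ+* FreeAlg k E Z.gens).comp
          (algHom f : FreeAlg k E Y.gens →ₙ+* FreeAlg k E Z.gens)).comp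
          ((semiEquiv E Y.gens σ).symm : FreeAlg k E Y.gens →ₙ+* FreeAlg k E Y.gens) with
        map_smul' := fun c a => by
          change semiEquiv E Z.gens σ (algHom f ((semiEquiv E Y.gens σ).symm (c • a))) =
            c • semiEquiv E Z.gens σ (algHom f ((semiEquiv E Y.gens σ).symm a))
          rw [semiEquiv_symm_smul, map_smul, semiEquiv_smul, RingEquiv.apply_symm_apply] } :
      FreeAlg k E Y.gens →ₙₐ[k] FreeAlg k E Z.gens)
  map_id Y := NonUnitalAlgHom.ext fun a => (semiEquiv E Y.gens σ).apply_symm_apply a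
  map_comp {X Y Z} f g := NonUnitalAlgHom.ext fun a => by
    change semiEquiv E Z.gens σ (algHom g (algHom f ((semiEquiv E X.gens σ).symm a))) =
      semiEquiv E Z.gens σ (algHom g ((semiEquiv E Y.gens σ).symm
        (semiEquiv E Y.gens σ (algHom f ((semiEquiv E X.gens σ).symm a)))))
    rw [RingEquiv.symm_apply_apply]

theorem twistFunctor_comp_symm (σ : k ≃+* k) :
    twistFunctor E σ ⋙ twistFunctor E σ.symm = 𝟭 (FreeCat k E) := by
  refine CategoryTheory.Functor.ext (fun _ => rfl) fun Y Z f =>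
    NonUnitalAlgHom.ext fun (a : FreeAlg k E Y.gens) => ?_
  change (semiEquiv E Z.gens σ).symm (semiEquiv E Z.gens σ (algHom f
    ((semiEquiv E Y.gens σ).symm (semiEquiv E Y.gens σ a)))) = algHom f a
  rw [RingEquiv.symm_apply_apply, RingEquiv.symm_apply_apply]

theorem isSemilinear_twistFunctor (σ : k ≃+* k) : IsSemilinear (twistFunctor E σ) σ := by
  refine ⟨fun Y => semiEquiv E Y.gens σ, fun Y => semiEquiv_smul σ, fun {Y Z} f a => ?_⟩
  change semiEquiv E Z.gens σ (algHom f a) =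
    semiEquiv E Z.gens σ (algHom f ((semiEquiv E Y.gens σ).symm (semiEquiv E Y.gens σ a)))
  rw [RingEquiv.symm_apply_apply]

/-- The automorphism of `Θ⁰` defined by an automorphism of the ground field. -/
def twistAut (E : Set (FreeNonUnitalNonAssocAlgebra ℤ ℕ)) (σ : k ≃+* k) :
    CategoryAut (FreeCat k E) where
  hom := (twistFunctor E σ).toCatHom
  inv := (twistFunctor E σ.symm).toCatHom
  hom_inv_id := congrArg Functor.toCatHom (twistFunctor_comp_symm σ)
  inv_hom_id := congrArg Functor.toCatHom (twistFunctor_comp_symm σ.symm)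

/-! ### Homogeneous elements in two variables -/

/-- The object of `Θ⁰` with two generators. -/
def pair (k : Type u) [Field k] (E : Set (FreeNonUnitalNonAssocAlgebra ℤ ℕ)) : FreeCat k E :=
  ⟨{0, 1}⟩

/-- The first generator of the free algebra with two generators. -/
def gen₀ (k : Type u) [Field k] (E : Set (FreeNonUnitalNonAssocAlgebra ℤ ℕ)) :
    FreeAlg k E (pair k E).gens :=
  of k E _ (⟨0, by simp [pair]⟩ : (pair k E).gens)

/-- The second generator of the free algebra with two generators. -/
def gen₁ (k : Type u) [Field k] (E : Set (FreeNonUnitalNonAssocAlgebra ℤ ℕ)) :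
    FreeAlg k E (pair k E).gens :=
  of k E _ (⟨1, by simp [pair]⟩ : (pair k E).gens)

theorem pair_cases {p : (pair k E).gens → Prop} (h0 : p ⟨0, by simp [pair]⟩)
    (h1 : p ⟨1, by simp [pair]⟩) (x : (pair k E).gens) : p x := by
  obtain ⟨n, hn⟩ := x
  have : n = 0 ∨ n = 1 := by simpa [pair] using hn
  rcases this with rfl | rfl
  exacts [h0, h1]

theorem pair_hom_ext {Y : FreeCat k E} {f g : pair k E ⟶ Y}
    (h0 : algHom f (gen₀ k E) = algHom g (gen₀ k E))
    (h1 : algHom f (gen₁ k E) = algHom g (gen₁ k E)) : f = g :=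
  freeCat_hom_ext (pair_cases h0 h1)

/-- Evaluation of the elements of the free algebra with two generators. -/
def eval₂ {Y : FreeCat k E} (a b : FreeAlg k E Y.gens) : pair k E ⟶ Y :=
  homMk fun x => if x.1 = 0 then a else b

@[simp]
theorem eval₂_gen₀ {Y : FreeCat k E} (a b : FreeAlg k E Y.gens) :
    algHom (eval₂ a b) (gen₀ k E) = a :=
  homMk_of _ _

@[simp]
theorem eval₂_gen₁ {Y : FreeCat k E} (a b : FreeAlg k E Y.gens) :
    algHom (eval₂ a b) (gen₁ k E) = b :=
  homMk_of _ _

theorem eq_linear_of_eval₂ [CharZero k] (q : FreeAlg k E (pair k E).gens)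
    (hq : algHom (eval₂ ((2 : k) • gen₀ k E) ((2 : k) • gen₁ k E)) q = (2 : k) • q) :
    ∃ c d : k, q = c • gen₀ k E + d • gen₁ k E := by
  have h := mem_span_monomial_of_smul
    (algHom (eval₂ ((2 : k) • gen₀ k E) ((2 : k) • gen₁ k E)))
    (pair_cases (eval₂_gen₀ _ _) (eval₂_gen₁ _ _)) 1 q (by rw [hq, pow_one])
  have hle : Submodule.span k (monomial k E '' {m : FreeMagma (pair k E).gens | m.length = 1}) ≤
      Submodule.span k {gen₀ k E, gen₁ k E} := by
    rw [Submodule.span_le]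
    rintro _ ⟨m, hm, rfl⟩
    obtain ⟨x, rfl⟩ := FreeMagma.exists_of_length_eq_one hm
    rw [monomial_of]
    exact pair_cases (p := fun x => of k E _ x ∈ Submodule.span k {gen₀ k E, gen₁ k E})
      (Submodule.subset_span (Or.inl rfl)) (Submodule.subset_span (Or.inr rfl)) x
  obtain ⟨c, d, h⟩ := Submodule.mem_span_pair.1 (hle h)
  exact ⟨c, d, h.symm⟩

/-- Of the four words of degree 2, the squares vanish and the two mixed ones differ by a sign. -/
theorem eq_smul_mul_of_eval₂ [CharZero k] (q : FreeAlg k E (pair k E).gens)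
    (hq : algHom (eval₂ ((2 : k) • gen₀ k E) ((2 : k) • gen₁ k E)) q = (4 : k) • q) :
    ∃ c : k, q = c • (gen₀ k E * gen₁ k E) := by
  have h := mem_span_monomial_of_smul
    (algHom (eval₂ ((2 : k) • gen₀ k E) ((2 : k) • gen₁ k E)))
    (pair_cases (eval₂_gen₀ _ _) (eval₂_gen₁ _ _)) 2 q (by rw [hq]; norm_num)
  have hV := inVariety_freeAlg k E (pair k E).gens
  have hle : Submodule.span k (monomial k E '' {m : FreeMagma (pair k E).gens | m.length = 2}) ≤
      Submodule.span k {gen₀ k E * gen₁ k E} := by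
    rw [Submodule.span_le]
    rintro _ ⟨m, hm, rfl⟩
    obtain ⟨x, y, rfl⟩ := FreeMagma.exists_of_length_eq_two hm
    rw [monomial_mul, monomial_of, monomial_of]
    have h01 : gen₀ k E * gen₁ k E ∈ Submodule.span k {gen₀ k E * gen₁ k E} :=
      Submodule.mem_span_singleton_self _
    refine pair_cases (p := fun x => ∀ y, of k E _ x * of k E _ y ∈
      Submodule.span k {gen₀ k E * gen₁ k E}) (pair_cases ?_ ?_) (pair_cases ?_ ?_) x y
    · exact hV.mul_self (k := k) (gen₀ k E) ▸ zero_mem _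
    · exact h01
    · exact hV.1 (gen₁ k E) (gen₀ k E) ▸ neg_mem h01
    · exact hV.mul_self (k := k) (gen₁ k E) ▸ zero_mem _
  obtain ⟨c, h⟩ := Submodule.mem_span_singleton.1 (hle h)
  exact ⟨c, h.symm⟩

/-! ### Transport of elements along an equivalence -/

/-- The scalar endomorphisms of the free algebra with a single generator. -/
theorem exists_algHom_eq_smul [CharZero k] (f : single k E ⟶ single k E) :
    ∃ c : k, ∀ a, algHom f a = c • a := by
  obtain ⟨c, hc⟩ := freeAlg_eq_smul_of (algHom f (gen k E))
  refine ⟨c, fun a => ?_⟩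
  obtain ⟨d, rfl⟩ := freeAlg_eq_smul_of a
  rw [map_smul]
  exact (congrArg (d • ·) hc).trans (smul_comm _ _ _)

/-- Equivalences map the object with a single generator to an object with a single generator. -/
theorem exists_unique_gens
    (hE : ∃ (A : Type u) (_ : NonUnitalNonAssocRing A) (_ : Module k A)
      (_ : IsScalarTower k A A) (_ : SMulCommClass k A A), InVariety E A ∧ Nontrivial A)
    [CharZero k] (G : FreeCat k E ⥤ FreeCat k E) [G.Full] [G.Faithful] :
    Nonempty (Unique (G.obj (single k E)).gens) := by
  have hne : Nonempty (G.obj (single k E)).gens := by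
    by_contra h
    rw [not_nonempty_iff] at h
    -- Without generators the image has a single endomorphism, so zero and the identity of `F(x)`
    -- would coincide.
    have h1 : elem (0 : FreeAlg k E (single k E).gens) = 𝟙 _ :=
      G.map_injective (freeCat_hom_ext fun x => isEmptyElim x)
    have h2 := elem_gen (0 : FreeAlg k E (single k E).gens)
    rw [h1] at h2
    exact of_ne_zero hE default h2
  obtain ⟨i⟩ := hne
  refine ⟨⟨⟨i⟩, fun j => ?_⟩⟩
  by_contra hj
  have hij : ¬ j = i := hj
  -- Endomorphisms of `F(x)` are scalars, hence commute; a full and faithful `G` carries this over.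
  have hcomm : ∀ f g : G.obj (single k E) ⟶ G.obj (single k E), f ≫ g = g ≫ f := by
    intro f g
    obtain ⟨f, rfl⟩ := G.map_surjective f
    obtain ⟨g, rfl⟩ := G.map_surjective g
    rw [← G.map_comp, ← G.map_comp]
    congr 1
    obtain ⟨c, hc⟩ := exists_algHom_eq_smul f
    obtain ⟨d, hd⟩ := exists_algHom_eq_smul g
    refine single_hom_ext ?_
    rw [algHom_comp, algHom_comp, hc, hd, hc, hd, smul_comm]
  classical
  -- With `i ≠ j`, `e j ≫ e i` kills the generator `i`, while `e i ≫ e j` sends it to the generator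
  -- `j`.
  let e (l : (G.obj (single k E)).gens) : G.obj (single k E) ⟶ G.obj (single k E) :=
    homMk fun x => if x = i then of k E _ l else 0
  have h := congrArg (fun f => algHom f (of k E _ i)) (hcomm (e j) (e i))
  simp only [algHom_comp, e, homMk_of, if_true, if_neg hij] at h
  exact of_ne_zero hE j h.symm

/-- A bijection between a free algebra and its image under `G` defined by the value of `G` on
the morphisms from the free algebra with a single generator. -/
def transport (G : FreeCat k E ⥤ FreeCat k E) (e : FreeAlg k E (G.obj (single k E)).gens)
    {Y : FreeCat k E} (a : FreeAlg k E Y.gens) : FreeAlg k E (G.obj Y).gens :=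
  algHom (G.map (elem a)) e

theorem transport_algHom (G : FreeCat k E ⥤ FreeCat k E)
    (e : FreeAlg k E (G.obj (single k E)).gens) {Y Z : FreeCat k E} (f : Y ⟶ Z)
    (a : FreeAlg k E Y.gens) :
    transport G e (algHom f a) = algHom (G.map f) (transport G e a) := by
  have : elem (algHom f a) = elem a ≫ f :=
    single_hom_ext (by rw [elem_gen, algHom_comp, elem_gen])
  rw [transport, this, G.map_comp, algHom_comp, transport]

section Transport

variable (G : FreeCat k E ⥤ FreeCat k E) [hu : Unique (G.obj (single k E)).gens]

/-- The generator of the image of the free algebra with a single generator. -/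
def imageGen : FreeAlg k E (G.obj (single k E)).gens := of k E _ default

theorem image_hom_ext {Y : FreeCat k E} {f g : G.obj (single k E) ⟶ Y}
    (h : algHom f (imageGen G) = algHom g (imageGen G)) : f = g :=
  freeCat_hom_ext fun x => by rw [Unique.eq_default x]; exact h

/-- Elements of the image of `Y` are the morphisms to it from the image of `F(x)`, which is free on
one generator too. -/
theorem transport_bijective [G.Full] [G.Faithful] (Y : FreeCat k E) :
    Function.Bijective (transport G (imageGen G) (Y := Y)) := by
  constructor
  · intro a b h
    have h1 : elem a = elem b := G.map_injective (image_hom_ext G h)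
    rw [← elem_gen a, h1, elem_gen]
  · intro b
    let g : G.obj (single k E) ⟶ G.obj Y := homMk fun _ => b
    obtain ⟨f, hf⟩ := G.map_surjective g
    refine ⟨algHom f (gen k E), ?_⟩
    have h1 : elem (algHom f (gen k E)) = f := single_hom_ext (elem_gen _)
    rw [transport, h1, hf]
    exact homMk_of _ _

/-- The morphism of `c • a` factors through multiplication by `c` on `F(x)`, whose image under `G`
is again a scalar, independent of `Y`. -/
theorem exists_transport_smul [CharZero k] (c : k) :
    ∃ d : k, ∀ (Y : FreeCat k E) (a : FreeAlg k E Y.gens),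
      transport G (imageGen G) (c • a) = d • transport G (imageGen G) a := by
  obtain ⟨d, hd⟩ := freeAlg_eq_smul_of (algHom (G.map (elem (c • gen k E))) (imageGen G))
  refine ⟨d, fun Y a => ?_⟩
  have : elem (c • a) = elem (c • gen k E) ≫ elem a :=
    single_hom_ext (by rw [elem_gen, algHom_comp, elem_gen, map_smul, elem_gen])
  rw [transport, this, G.map_comp, algHom_comp, hd, map_smul]
  rfl

/-- Makes a prescribed scalar, such as 2, available on the image side before additivity is known. -/
theorem transport_smul_surjective [CharZero k] [G.Full] (d : k) :
    ∃ c : k, ∀ (Y : FreeCat k E) (a : FreeAlg k E Y.gens),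
      transport G (imageGen G) (c • a) = d • transport G (imageGen G) a := by
  let g : G.obj (single k E) ⟶ G.obj (single k E) := homMk fun _ => d • imageGen G
  obtain ⟨f, hf⟩ := G.map_surjective g
  obtain ⟨c, hc⟩ := exists_algHom_eq_smul f
  refine ⟨c, fun Y a => ?_⟩
  have : elem (c • a) = f ≫ elem a :=
    single_hom_ext (by rw [elem_gen, algHom_comp, hc, map_smul, elem_gen])
  rw [transport, this, G.map_comp, algHom_comp, hf]
  have h1 : algHom g (imageGen G) = d • imageGen G := homMk_of _ _
  rw [h1, map_smul]
  rfl

theorem transport_zero [G.Full] [G.Faithful] (Y : FreeCat k E) :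
    transport G (imageGen G) (0 : FreeAlg k E Y.gens) = 0 := by
  let z : Y ⟶ Y := (0 : FreeAlg k E Y.gens →ₙₐ[k] FreeAlg k E Y.gens)
  obtain ⟨a, ha⟩ := (transport_bijective G Y).2 0
  have h := transport_algHom G (imageGen G) z a
  rw [ha, map_zero] at h
  exact h

/-- The images of the two generators under an equivalence freely generate the image of the free
algebra with two generators. -/
theorem exists_image_pair_inverse [G.IsEquivalence] :
    ∃ h : G.obj (pair k E) ⟶ pair k E,
      eval₂ (transport G (imageGen G) (gen₀ k E)) (transport G (imageGen G) (gen₁ k E)) ≫ h =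
        𝟙 _ ∧
      h ≫ eval₂ (transport G (imageGen G) (gen₀ k E)) (transport G (imageGen G) (gen₁ k E)) =
        𝟙 _ := by
  set s₀ := transport G (imageGen G) (gen₀ k E)
  set s₁ := transport G (imageGen G) (gen₁ k E)
  -- Uniqueness half of freeness on `s₀`, `s₁`, restricted to targets in the image of `G`.
  have hext : ∀ {Y : FreeCat k E} (f g : G.obj (pair k E) ⟶ G.obj Y),
      algHom f s₀ = algHom g s₀ → algHom f s₁ = algHom g s₁ → f = g := by
    intro Y f g h0 h1
    obtain ⟨f, rfl⟩ := G.map_surjective f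
    obtain ⟨g, rfl⟩ := G.map_surjective g
    rw [← transport_algHom, ← transport_algHom] at h0 h1
    exact congrArg G.map
      (pair_hom_ext ((transport_bijective G Y).1 h0) ((transport_bijective G Y).1 h1))
  -- Essential surjectivity puts `F(x, y)` itself in the image up to isomorphism, which yields a
  -- morphism with `s₀ ↦ x`, `s₁ ↦ y`.
  let i := G.objObjPreimageIso (pair k E)
  obtain ⟨u, hu⟩ := (transport_bijective G _).2 (algHom i.inv (gen₀ k E))
  obtain ⟨v, hv⟩ := (transport_bijective G _).2 (algHom i.inv (gen₁ k E))
  have hi : ∀ a, algHom i.hom (algHom i.inv a) = a := fun a =>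
    congrArg (fun f => algHom f a) i.inv_hom_id
  have h0 : algHom (G.map (eval₂ u v) ≫ i.hom) s₀ = gen₀ k E := by
    rw [algHom_comp, ← transport_algHom, eval₂_gen₀, hu, hi]
  have h1 : algHom (G.map (eval₂ u v) ≫ i.hom) s₁ = gen₁ k E := by
    rw [algHom_comp, ← transport_algHom, eval₂_gen₁, hv, hi]
  refine ⟨G.map (eval₂ u v) ≫ i.hom, pair_hom_ext ?_ ?_, hext _ _ ?_ ?_⟩
  · rw [algHom_comp, eval₂_gen₀, h0, algHom_id]
  · rw [algHom_comp, eval₂_gen₁, h1, algHom_id]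
  · rw [algHom_comp, h0, eval₂_gen₀, algHom_id]
  · rw [algHom_comp, h1, eval₂_gen₁, algHom_id]

/-- Writing the transport of `p` in the free generators `s x`, `s y` gives `q`; naturality along `x
↦ a`, `y ↦ b` does the rest. -/
theorem exists_transport_eval₂ [G.IsEquivalence] (p : FreeAlg k E (pair k E).gens) :
    ∃ q : FreeAlg k E (pair k E).gens, ∀ (Y : FreeCat k E) (a b : FreeAlg k E Y.gens),
      transport G (imageGen G) (algHom (eval₂ a b) p) =
        algHom (eval₂ (transport G (imageGen G) a) (transport G (imageGen G) b)) q := by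
  obtain ⟨h, -, hh⟩ := exists_image_pair_inverse G
  refine ⟨algHom h (transport G (imageGen G) p), fun Y a b => ?_⟩
  have h1 : eval₂ (transport G (imageGen G) a) (transport G (imageGen G) b) =
      eval₂ (transport G (imageGen G) (gen₀ k E)) (transport G (imageGen G) (gen₁ k E)) ≫
        G.map (eval₂ a b) := by
    refine pair_hom_ext ?_ ?_
    · rw [algHom_comp, eval₂_gen₀, eval₂_gen₀, ← transport_algHom, eval₂_gen₀]
    · rw [algHom_comp, eval₂_gen₁, eval₂_gen₁, ← transport_algHom, eval₂_gen₁]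
  rw [h1, ← algHom_comp, ← Category.assoc, hh, Category.id_comp, transport_algHom]

/-- Homogeneity only has to be tested at `s x`, `s y`, since these are free generators. -/
theorem eval₂_smul_of_transport [G.IsEquivalence] (q : FreeAlg k E (pair k E).gens) (r : k)
    (hq : algHom (eval₂ ((2 : k) • transport G (imageGen G) (gen₀ k E))
        ((2 : k) • transport G (imageGen G) (gen₁ k E))) q =
      r • algHom (eval₂ (transport G (imageGen G) (gen₀ k E))
        (transport G (imageGen G) (gen₁ k E))) q) :
    algHom (eval₂ ((2 : k) • gen₀ k E) ((2 : k) • gen₁ k E)) q = r • q := by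
  obtain ⟨h, hh, -⟩ := exists_image_pair_inverse G
  have hinv : ∀ a, algHom h (algHom (eval₂ (transport G (imageGen G) (gen₀ k E))
      (transport G (imageGen G) (gen₁ k E))) a) = a := fun a =>
    congrArg (fun f => algHom f a) hh
  have h0 := hinv (gen₀ k E)
  have h1 := hinv (gen₁ k E)
  rw [eval₂_gen₀] at h0
  rw [eval₂_gen₁] at h1
  have h2 := congrArg (algHom h) hq
  rw [map_smul, hinv, ← algHom_comp] at h2
  rw [← h2]
  refine congrArg (fun f => algHom f q) (pair_hom_ext ?_ ?_)
  · rw [algHom_comp, eval₂_gen₀, eval₂_gen₀, map_smul, h0]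
  · rw [algHom_comp, eval₂_gen₁, eval₂_gen₁, map_smul, h1]

theorem transport_add [CharZero k] [G.IsEquivalence] (Y : FreeCat k E)
    (a b : FreeAlg k E Y.gens) :
    transport G (imageGen G) (a + b) =
      transport G (imageGen G) a + transport G (imageGen G) b := by
  obtain ⟨q, hq⟩ := exists_transport_eval₂ G (gen₀ k E + gen₁ k E)
  simp only [map_add, eval₂_gen₀, eval₂_gen₁] at hq
  -- Transport is not yet known to take the scalar 2 to 2, so a scalar `r` that it does take to 2 is
  -- used.
  obtain ⟨r, hr⟩ := transport_smul_surjective G (2 : k)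
  obtain ⟨c, d, rfl⟩ := eq_linear_of_eval₂ q (eval₂_smul_of_transport G q 2 (by
    rw [← hr, ← hr, ← hq, ← hq, ← smul_add, hr]))
  simp only [map_add, map_smul, eval₂_gen₀, eval₂_gen₁] at hq
  -- Setting one argument to zero shows that `c` fixes `s a` and `d` fixes `s b`; `c = d = 1` is not
  -- needed.
  have hc := hq Y a 0
  have hd := hq Y 0 b
  rw [transport_zero, smul_zero, add_zero, add_zero] at hc
  rw [transport_zero, smul_zero, zero_add, zero_add] at hd
  rw [hq, ← hc, ← hd]

/-- By additivity transport now commutes with doubling, so doubling both arguments multiplies `q` by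
4, which forces degree 2. -/
theorem exists_transport_mul [CharZero k] [G.IsEquivalence] :
    ∃ c : k, ∀ (Y : FreeCat k E) (a b : FreeAlg k E Y.gens),
      transport G (imageGen G) (a * b) =
        c • (transport G (imageGen G) a * transport G (imageGen G) b) := by
  obtain ⟨q, hq⟩ := exists_transport_eval₂ G (gen₀ k E * gen₁ k E)
  simp only [map_mul, eval₂_gen₀, eval₂_gen₁] at hq
  have h2 : ∀ (Y : FreeCat k E) (a : FreeAlg k E Y.gens),
      transport G (imageGen G) ((2 : k) • a) = (2 : k) • transport G (imageGen G) a := by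
    intro Y a
    rw [two_smul, two_smul, transport_add]
  have h4 : (4 : k) = 2 * 2 := by norm_num
  obtain ⟨c, rfl⟩ := eq_smul_mul_of_eval₂ q (eval₂_smul_of_transport G q 4 (by
    rw [← h2, ← h2, ← hq, ← hq, smul_mul_smul_comm, mul_smul, h2, h2, h4, mul_smul]))
  simp only [map_mul, map_smul, eval₂_gen₀, eval₂_gen₁] at hq
  exact ⟨c, hq⟩

end Transport

/-- Equivalences of `Θ⁰` with itself are semilinear. -/
theorem exists_isSemilinear
    (hE : ∃ (A : Type u) (_ : NonUnitalNonAssocRing A) (_ : Module k A)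
      (_ : IsScalarTower k A A) (_ : SMulCommClass k A A), InVariety E A ∧ Nontrivial A)
    [CharZero k] (G : FreeCat k E ⥤ FreeCat k E) [G.IsEquivalence] :
    ∃ σ : k ≃+* k, IsSemilinear G σ := by
  obtain ⟨_⟩ := exists_unique_gens hE G
  choose φ hφ using exists_transport_smul G
  have hbij := transport_bijective G
  have hgen : transport G (imageGen G) (gen k E) ≠ 0 := fun h =>
    of_ne_zero hE default ((hbij _).1 (h.trans (transport_zero G _).symm))
  have hinj := smul_left_injective k hgen
  have hφbij : Function.Bijective φ := by
    constructor
    · intro c d h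
      have h1 := hφ c _ (gen k E)
      rw [h, ← hφ] at h1
      exact smul_left_injective k (of_ne_zero hE default : gen k E ≠ 0) ((hbij _).1 h1)
    · intro d
      obtain ⟨c, hc⟩ := transport_smul_surjective G d
      exact ⟨c, hinj ((hφ c _ _).symm.trans (hc _ _))⟩
  let σ : k ≃+* k :=
    { Equiv.ofBijective φ hφbij with
      map_mul' := fun c d => hinj (by
        change φ (c * d) • _ = (φ c * φ d) • _
        rw [← hφ, mul_smul, mul_smul, hφ, hφ])
      map_add' := fun c d => hinj (by
        change φ (c + d) • _ = (φ c + φ d) • _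
        rw [← hφ, add_smul, add_smul, transport_add, hφ, hφ]) }
  have main : ∀ r : k, r ≠ 0 → (∀ (Y : FreeCat k E) (a b : FreeAlg k E Y.gens),
      transport G (imageGen G) (a * b) =
        r • (transport G (imageGen G) a * transport G (imageGen G) b)) →
      IsSemilinear G σ := by
    intro r hr hmul
    -- Rescaling absorbs the factor: `r • s (a * b) = (r • s a) * (r • s b)`.
    refine ⟨fun Y =>
      { Equiv.ofBijective (fun a => r • transport G (imageGen G) a)
          ((MulAction.bijective₀ hr).comp (hbij Y)) with
        map_mul' := fun a b => ?_
        map_add' := fun a b => ?_ }, fun Y c a => ?_, fun {Y Z} f a => ?_⟩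
    · change r • transport G (imageGen G) (a * b) =
        (r • transport G (imageGen G) a) * (r • transport G (imageGen G) b)
      rw [hmul, smul_mul_smul_comm, mul_smul]
    · change r • transport G (imageGen G) (a + b) =
        r • transport G (imageGen G) a + r • transport G (imageGen G) b
      rw [transport_add, smul_add]
    · change r • transport G (imageGen G) (c • a) = φ c • r • transport G (imageGen G) a
      rw [hφ, smul_comm]
    · change r • transport G (imageGen G) (algHom f a) =
        algHom (G.map f) (r • transport G (imageGen G) a)
      rw [transport_algHom, map_smul]
  obtain ⟨r, hmul⟩ := exists_transport_mul G
  by_cases hr : r = 0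
  · have hzero : ∀ (Y : FreeCat k E) (a b : FreeAlg k E Y.gens), a * b = 0 := by
      intro Y a b
      apply (hbij Y).1
      rw [hmul, hr, zero_smul, transport_zero]
    refine ⟨σ, main 1 one_ne_zero fun Y a b => ?_⟩
    rw [hzero, hzero, transport_zero, smul_zero]
  · exact ⟨σ, main r hr hmul⟩

end Semilinear

end AnticommVariety

/-! ### The quotient group -/

theorem CategoryAut.isEquivalence {C : Type*} [Category C] (Φ : CategoryAut C) :
    Φ.hom.toFunctor.IsEquivalence :=
  have h := (Cat.equivOfIso (Φ : Cat.of C ≅ Cat.of C)).isEquivalence_functor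
  h

end

theorem mainTheorem5 {k : Type u} [Field k] [CharZero k]
    (E : Set (FreeNonUnitalNonAssocAlgebra ℤ ℕ))
    (hE : ∃ (A : Type u) (_ : NonUnitalNonAssocRing A) (_ : Module k A)
      (_ : IsScalarTower k A A) (_ : SMulCommClass k A A),
      AnticommVariety.InVariety E A ∧ Nontrivial A) :
    Nonempty
      (CategoryAut (AnticommVariety.FreeCat k E) ⧸ innerAut (AnticommVariety.FreeCat k E) ≃*
        RingAut k) := by
  have hex : ∀ Φ : CategoryAut (AnticommVariety.FreeCat k E),
      ∃ σ : k ≃+* k, AnticommVariety.IsSemilinear Φ.hom.toFunctor σ := fun Φ =>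
    @AnticommVariety.exists_isSemilinear k _ E hE _ Φ.hom.toFunctor (CategoryAut.isEquivalence Φ)
  choose σ hσ using hex
  let f : CategoryAut (AnticommVariety.FreeCat k E) →* RingAut k :=
    -- In both groups a product applies its right factor first, so no opposite group appears.
    MonoidHom.mk' σ fun Φ Ψ => (hσ (Φ * Ψ)).unique hE ((hσ Ψ).comp (hσ Φ))
  have hf : Function.Surjective f := fun τ =>
    ⟨AnticommVariety.twistAut E τ,
      (hσ _).unique hE (AnticommVariety.isSemilinear_twistFunctor τ)⟩
  have hker : innerAut (AnticommVariety.FreeCat k E) = f.ker := by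
    ext Φ
    rw [MonoidHom.mem_ker]
    refine (AnticommVariety.isSemilinear_refl_iff Φ.hom.toFunctor).symm.trans ⟨fun h => ?_,
      fun h => ?_⟩
    · exact (hσ Φ).unique hE h
    · have h' : σ Φ = RingEquiv.refl k := h
      exact h' ▸ hσ Φ
  exact ⟨(QuotientGroup.quotientMulEquivOfEq hker).trans
    (QuotientGroup.quotientKerEquivOfSurjective f hf)⟩
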